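/- Let $n\ge 1$, let $X$ be a random vector in $\mathbb R^n$ defined on a probability space, and suppose that $X$ has a log-concave density $f$ with respect to Lebesgue measure, i.e. $f:\mathbb R^n\to[0,\infty)$ satisfies $f(\lambda x+(1-\lambda)y)\ge f(x)^{\lambda}f(y)^{1-\lambda}$ for all $x,y\in\mathbb R^n$ and all $\lambda\in(0,1)$. Then $\log f(X)$ is integrable and, with $c=1/16$ (a constant that depends neither on $n$ nor on $f$), $$\mathbb P\Bigl\{\frac1{\sqrt n}\,\bigl|\log f(X)-\mathbb E\log f(X)\bigr|\ge t\Bigr\}\le 3e^{-ct^2}\qquad\text{for all } 0\le t\le 2\sqrt n .$$ -/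

import Mathlib

open MeasureTheory

/-- A function `f ≥ 0` on a real vector space is log-concave if
`f (a x + b y) ≥ f x ^ a * f y ^ b` for all points `x, y` and all weights `a, b > 0` with
`a + b = 1`, that is, if `log f` is concave as a function with values in `[-∞, ∞)`
(the value `0` is allowed, and `0 ^ a = 0` because `a > 0`). -/
structure IsLogConcave {E : Type*} [AddCommGroup E] [Module ℝ E] (f : E → ℝ) : Prop where
  nonneg : ∀ x, 0 ≤ f x
  rpow_mul_rpow_le : ∀ x y : E, ∀ a b : ℝ, 0 < a → 0 < b → a + b = 1 →
    f x ^ a * f y ^ b ≤ f (a • x + b • y)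

/-- The random vector `X` with values in `ℝⁿ` has the density `f` with respect to Lebesgue
measure: `X` is a random vector, `f` is a nonnegative Lebesgue measurable function, and
the law of `X` is `f(x) dx`. -/
structure HasDensity {Ω : Type*} [MeasurableSpace Ω] {n : ℕ} (X : Ω → EuclideanSpace ℝ (Fin n))
    (P : Measure Ω) (f : EuclideanSpace ℝ (Fin n) → ℝ) : Prop where
  aemeasurable : AEMeasurable X P
  density_aemeasurable : AEMeasurable f volume
  density_nonneg : ∀ x, 0 ≤ f x
  map_eq : P.map X = volume.withDensity (fun x => ENNReal.ofReal (f x))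

/-! Put Y = log f(X), so that E exp((α-1)Y) = ∫ f^α for α > 0. Rescaling gives α^n ∫ f^α = ∫
f(x/α)^α dx, and (x, α) ↦ f(x/α)^α is jointly log-concave, being the perspective of a log-concave
function. By Prékopa–Leindler, G(α) = α^n ∫ f^α is log-concave on (0, ∞)
(`IsLogConcave.lintegral_rpow_log_concave`).

Since G(1) = 1, log-concavity makes G finite everywhere, and log G lies below its tangent at 1,
whose slope is n + E Y. Hence log E exp(sY) ≤ s E Y + n(s - log(1+s)) for s > -1
(`cgf_le_of_log_concave`), with equality when f is the density of n independent exponential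
variables. Chernoff's bound for both tails at deviation ns, with s = t/√n ≤ 2, finishes the proof.
-/

open MeasureTheory
open scoped Pointwise ENNReal

/-! ### Brunn–Minkowski on the line. -/

/-- The one-dimensional Brunn–Minkowski inequality for compact sets. -/
theorem IsCompact.volume_add_le_volume_add {K L : Set ℝ} (hK : IsCompact K) (hL : IsCompact L)
    (hKn : K.Nonempty) (hLn : L.Nonempty) : volume K + volume L ≤ volume (K + L) := by
  obtain ⟨k, hk, hkmax⟩ := hK.exists_isGreatest hKn
  obtain ⟨l, hl, hlmin⟩ := hL.exists_isLeast hLn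
  -- With k = max K and l = min L, these two translates can meet only at k + l.
  have hsub : (l +ᵥ K) ∪ (k +ᵥ L) ⊆ K + L := by
    rintro _ (⟨x, hx, rfl⟩ | ⟨x, hx, rfl⟩)
    · exact ⟨x, hx, l, hl, by simp [add_comm]⟩
    · exact ⟨k, hk, x, hx, by simp⟩
  have hdisj : AEDisjoint volume (l +ᵥ K) (k +ᵥ L) := by
    refine measure_mono_null (t := {l + k}) ?_ (by simp)
    rintro _ ⟨⟨x, hx, rfl⟩, ⟨y, hy, hxy⟩⟩
    have h1 := hkmax hx
    have h2 := hlmin hy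
    simp only [vadd_eq_add] at hxy
    simp only [vadd_eq_add, Set.mem_singleton_iff]
    linarith
  calc volume K + volume L = volume (l +ᵥ K) + volume (k +ᵥ L) := by
        rw [measure_vadd, measure_vadd]
    _ = volume ((l +ᵥ K) ∪ (k +ᵥ L)) :=
        (measure_union₀ (hL.vadd k).measurableSet.nullMeasurableSet hdisj).symm
    _ ≤ volume (K + L) := measure_mono hsub

/-- The one-dimensional Brunn–Minkowski inequality. -/
theorem MeasurableSet.volume_add_le_volume_of_add_subset {A B C : Set ℝ} (hA : MeasurableSet A)
    (hB : MeasurableSet B) (hAn : A.Nonempty) (hBn : B.Nonempty) (hC : A + B ⊆ C) :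
    volume A + volume B ≤ volume C := by
  have key : ∀ K ⊆ A, IsCompact K → ∀ L ⊆ B, IsCompact L → volume K + volume L ≤ volume C := by
    obtain ⟨x, hx⟩ := hAn
    obtain ⟨y, hy⟩ := hBn
    intro K hKA hK L hLB hL
    -- Inner regularity also tests empty compact sets; an inserted point makes them nonempty.
    calc volume K + volume L ≤ volume (insert x K) + volume (insert y L) := by
          gcongr <;> exact Set.subset_insert _ _
      _ ≤ volume (insert x K + insert y L) :=
          (hK.insert x).volume_add_le_volume_add (hL.insert y) (Set.insert_nonempty _ _)
            (Set.insert_nonempty _ _)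
      _ ≤ volume C := measure_mono ((Set.add_subset_add (Set.insert_subset hx hKA)
            (Set.insert_subset hy hLB)).trans hC)
  rw [hA.measure_eq_iSup_isCompact, hB.measure_eq_iSup_isCompact]
  simp only [iSup_and']
  exact ENNReal.biSup_add_biSup_le' ⟨∅, by simp⟩ ⟨∅, by simp⟩
    fun K hK L hL => key K hK.1 hK.2 L hL.1 hL.2

theorem MeasurableSet.weighted_volume_add_le {A B C : Set ℝ} (hA : MeasurableSet A)
    (hB : MeasurableSet B) (hAn : A.Nonempty) (hBn : B.Nonempty) {a b : ℝ} (ha : 0 < a)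
    (hb : 0 < b) (hC : ∀ x ∈ A, ∀ y ∈ B, a * x + b * y ∈ C) :
    ENNReal.ofReal a * volume A + ENNReal.ofReal b * volume B ≤ volume C := by
  have := (hA.const_smul_of_ne_zero ha.ne').volume_add_le_volume_of_add_subset
    (hB.const_smul_of_ne_zero hb.ne') (hAn.smul_set (a := a)) (hBn.smul_set (a := b)) (C := C) (by
      rintro _ ⟨_, ⟨x, hx, rfl⟩, _, ⟨y, hy, rfl⟩, rfl⟩
      exact hC x hx y hy)
  simpa [Measure.addHaar_smul, abs_of_pos, ha, hb] using this

/-! ### Prékopa–Leindler, by induction on the dimension. -/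

/-- Layer cake plus Brunn–Minkowski for the superlevel sets. Those of f and g are nonempty exactly
at the levels below their common supremum 1, which is why both are normalised. -/
theorem lintegral_weighted_add_le_of_sup_eq_one {f g h : ℝ → ℝ} (hf : Measurable f)
    (hg : Measurable g) (hh : Measurable h) (hf0 : 0 ≤ f) (hg0 : 0 ≤ g) (hh0 : 0 ≤ h)
    (hf1 : f ≤ 1) (hg1 : g ≤ 1) (hfs : ∀ r < 1, ∃ x, r < f x) (hgs : ∀ r < 1, ∃ x, r < g x)
    {a b : ℝ} (ha : 0 < a) (hb : 0 < b) (hab : a + b = 1)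
    (hfgh : ∀ x y, f x ^ a * g y ^ b ≤ h (a * x + b * y)) :
    ENNReal.ofReal a * (∫⁻ x, ENNReal.ofReal (f x)) + ENNReal.ofReal b * ∫⁻ x, ENNReal.ofReal (g x)
      ≤ ∫⁻ x, ENNReal.ofReal (h x) := by
  have meas : ∀ u : ℝ → ℝ, Measurable (fun t => volume {x | t < u x}) := fun u =>
    Antitone.measurable fun s t hst => measure_mono fun x hx => lt_of_le_of_lt hst hx
  rw [lintegral_eq_lintegral_meas_lt _ (.of_forall hf0) hf.aemeasurable,
    lintegral_eq_lintegral_meas_lt _ (.of_forall hg0) hg.aemeasurable,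
    lintegral_eq_lintegral_meas_lt _ (.of_forall hh0) hh.aemeasurable,
    ← lintegral_const_mul _ (meas f), ← lintegral_const_mul _ (meas g),
    ← lintegral_add_left ((meas f).const_mul _)]
  refine setLIntegral_mono (meas h) fun t (ht : 0 < t) => ?_
  rcases lt_or_ge t 1 with ht1 | ht1
  · refine (measurableSet_lt measurable_const hf).weighted_volume_add_le
      (measurableSet_lt measurable_const hg) (hfs t ht1) (hgs t ht1) ha hb ?_
    intro x hx y hy
    refine lt_of_lt_of_le ?_ (hfgh x y)
    calc t = t ^ a * t ^ b := by rw [← Real.rpow_add ht, hab, Real.rpow_one]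
      _ < f x ^ a * g y ^ b :=
        mul_lt_mul'' (Real.rpow_lt_rpow ht.le hx ha) (Real.rpow_lt_rpow ht.le hy hb)
          (by positivity) (by positivity)
  · have h1 : ∀ u : ℝ → ℝ, u ≤ 1 → {x | t < u x} = ∅ := fun u hu =>
      Set.eq_empty_of_forall_notMem fun x hx => absurd (hx.trans_le (hu x)) (not_lt.2 ht1)
    simp [h1 f hf1, h1 g hg1]

theorem ENNReal.rpow_mul_rpow_le_weighted_add (x y : ℝ≥0∞) {a b : ℝ} (ha : 0 < a) (hb : 0 < b)
    (hab : a + b = 1) : x ^ a * y ^ b ≤ ENNReal.ofReal a * x + ENNReal.ofReal b * y := by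
  have hc : a⁻¹.HolderConjugate b⁻¹ := by
    rw [Real.holderConjugate_iff]
    refine ⟨(one_lt_inv₀ ha).2 (by linarith), by simpa using hab⟩
  have := ENNReal.young_inequality (x ^ a) (y ^ b) hc
  rw [← ENNReal.rpow_mul, ← ENNReal.rpow_mul, mul_inv_cancel₀ ha.ne', mul_inv_cancel₀ hb.ne',
    ENNReal.rpow_one, ENNReal.rpow_one, ENNReal.ofReal_inv_of_pos ha,
    ENNReal.ofReal_inv_of_pos hb, div_eq_mul_inv, div_eq_mul_inv, inv_inv, inv_inv] at this
  rwa [mul_comm (ENNReal.ofReal a), mul_comm (ENNReal.ofReal b)]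

/-- A measure space whose measure satisfies the Prékopa–Leindler inequality. -/
def PrekopaLeindler (E : Type*) [AddCommGroup E] [Module ℝ E] [MeasureSpace E] : Prop :=
  ∀ (f g h : E → ℝ≥0∞), Measurable f → Measurable g → Measurable h →
    ∀ a b : ℝ, 0 < a → 0 < b → a + b = 1 →
      (∀ x y, f x ^ a * g y ^ b ≤ h (a • x + b • y)) →
        (∫⁻ x, f x) ^ a * (∫⁻ x, g x) ^ b ≤ ∫⁻ x, h x

/-- Dividing by the suprema reduces to the normalised case, whose arithmetic mean dominates the
geometric one. -/
theorem lintegral_rpow_mul_le_of_bounded {f g h : ℝ → ℝ≥0∞} (hf : Measurable f)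
    (hg : Measurable g) (hh : Measurable h) {a b : ℝ} (ha : 0 < a) (hb : 0 < b) (hab : a + b = 1)
    (hfgh : ∀ x y, f x ^ a * g y ^ b ≤ h (a * x + b * y))
    (hfM : ⨆ x, f x ≠ ∞) (hgM : ⨆ x, g x ≠ ∞) :
    (∫⁻ x, f x) ^ a * (∫⁻ x, g x) ^ b ≤ ∫⁻ x, h x := by
  set M := ⨆ x, f x with hM
  set N := ⨆ x, g x with hN
  rcases eq_or_ne M 0 with hM0 | hM0
  · have : ∀ x, f x = 0 := by simpa [hM] using hM0
    simp [this, ha]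
  rcases eq_or_ne N 0 with hN0 | hN0
  · have : ∀ x, g x = 0 := by simpa [hN] using hN0
    simp [this, hb]
  have hM' : M ^ a ≠ 0 ∧ M ^ a ≠ ∞ := ⟨by simp [hM0, hfM], by simp [ha.le, hfM]⟩
  have hN' : N ^ b ≠ 0 ∧ N ^ b ≠ ∞ := ⟨by simp [hN0, hgM], by simp [hb.le, hgM]⟩
  set D := M ^ a * N ^ b with hD
  have hD0 : D ≠ 0 := mul_ne_zero hM'.1 hN'.1
  have hDt : D ≠ ∞ := ENNReal.mul_ne_top hM'.2 hN'.2
  have norm_le : ∀ (u : ℝ → ℝ≥0∞) x, u x / (⨆ x, u x) ≤ 1 := fun u x =>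
    ENNReal.div_le_of_le_mul (by simpa using le_iSup u x)
  have norm_sup : ∀ (u : ℝ → ℝ≥0∞), (⨆ x, u x) ≠ 0 → (⨆ x, u x) ≠ ∞ → ∀ r < (1 : ℝ),
      ∃ x, r < (u x / ⨆ x, u x).toReal := by
    intro u h0 ht r hr
    have : ENNReal.ofReal r < 1 := by simpa using hr
    have h2 : ENNReal.ofReal r * (⨆ x, u x) < ⨆ x, u x := by
      simpa using ENNReal.mul_lt_mul_left h0 ht this
    obtain ⟨x, hx⟩ := lt_iSup_iff.1 h2
    refine ⟨x, ?_⟩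
    have hx' := (ENNReal.lt_div_iff_mul_lt (.inl h0) (.inl ht)).2 hx
    rw [← ENNReal.ofReal_toReal (ne_top_of_le_ne_top (by simp) (norm_le u x)),
      ENNReal.ofReal_lt_ofReal_iff'] at hx'
    exact hx'.1
  -- `toReal` would send an infinite value of h to 0. Capping at 1 avoids this and is harmless,
  -- since the normalised product is at most 1.
  have key := lintegral_weighted_add_le_of_sup_eq_one (f := fun x => (f x / M).toReal)
    (g := fun x => (g x / N).toReal) (h := fun x => (min (h x / D) 1).toReal)
    (hf.div_const _).ennreal_toReal (hg.div_const _).ennreal_toReal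
    ((hh.div_const _).min measurable_const).ennreal_toReal
    (fun x => ENNReal.toReal_nonneg) (fun x => ENNReal.toReal_nonneg)
    (fun x => ENNReal.toReal_nonneg)
    (fun x => ENNReal.toReal_mono (by simp) (norm_le f x))
    (fun x => ENNReal.toReal_mono (by simp) (norm_le g x))
    (norm_sup f hM0 hfM) (norm_sup g hN0 hgM) ha hb hab (by
      intro x y
      simp only [ENNReal.toReal_rpow, ← ENNReal.toReal_mul]
      refine ENNReal.toReal_mono (by simp) (le_min ?_ ?_)
      · rw [ENNReal.div_rpow_of_nonneg _ _ ha.le, ENNReal.div_rpow_of_nonneg _ _ hb.le, hD,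
          ← ENNReal.mul_div_mul_comm (.inr hN'.2) (.inl hM'.2)]
        exact ENNReal.div_le_div_right (hfgh x y) _
      · exact mul_le_one' (ENNReal.rpow_le_one (norm_le f x) ha.le)
          (ENNReal.rpow_le_one (norm_le g y) hb.le))
  have hfe : ∀ x, ENNReal.ofReal (f x / M).toReal = f x / M := fun x =>
    ENNReal.ofReal_toReal (ne_top_of_le_ne_top (by simp) (norm_le f x))
  have hge : ∀ x, ENNReal.ofReal (g x / N).toReal = g x / N := fun x =>
    ENNReal.ofReal_toReal (ne_top_of_le_ne_top (by simp) (norm_le g x))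
  have hhe : ∀ x, ENNReal.ofReal (min (h x / D) 1).toReal = min (h x / D) 1 := fun x =>
    ENNReal.ofReal_toReal (ne_top_of_le_ne_top (by simp) (min_le_right _ _))
  simp only [hfe, hge, hhe] at key
  have h1 : (∫⁻ x, f x / M) ^ a * (∫⁻ x, g x / N) ^ b ≤ (∫⁻ x, h x) / D := by
    refine (ENNReal.rpow_mul_rpow_le_weighted_add _ _ ha hb hab).trans (key.trans ?_)
    simp only [div_eq_mul_inv, ← lintegral_mul_const _ hh]
    exact lintegral_mono fun x => min_le_left _ _
  simp only [div_eq_mul_inv, lintegral_mul_const _ hf, lintegral_mul_const _ hg] at h1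
  rw [ENNReal.mul_rpow_of_nonneg _ _ ha.le, ENNReal.mul_rpow_of_nonneg _ _ hb.le,
    mul_mul_mul_comm, ENNReal.inv_rpow, ENNReal.inv_rpow,
    ← ENNReal.mul_inv (.inl hM'.1) (.inl hM'.2), ← div_eq_mul_inv, ← div_eq_mul_inv] at h1
  rwa [ENNReal.div_le_iff hD0 hDt, ENNReal.div_mul_cancel hD0 hDt] at h1

theorem prekopaLeindler_real : PrekopaLeindler ℝ := by
  intro f g h hf hg hh a b ha hb hab hfgh
  have hsup : ∀ x : ℝ≥0∞, ⨆ n : ℕ, min x n = x := by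
    intro x
    rw [← inf_iSup_eq, ENNReal.iSup_natCast, inf_top_eq]
  have hmono : ∀ u : ℝ → ℝ≥0∞, Monotone fun (n : ℕ) x => min (u x) n := fun u m n hmn x =>
    min_le_min_left _ (by exact_mod_cast hmn)
  have hlim : ∀ u : ℝ → ℝ≥0∞, Measurable u → Filter.Tendsto (fun n : ℕ => ∫⁻ x, min (u x) n)
      Filter.atTop (nhds (∫⁻ x, u x)) := by
    intro u hu
    have := tendsto_atTop_iSup (f := fun n : ℕ => ∫⁻ x, min (u x) n)
      fun m n hmn => lintegral_mono (hmono u hmn)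
    rwa [← lintegral_iSup (fun n => hu.min measurable_const) (hmono u), funext fun x => hsup (u x)]
      at this
  have hle : ∀ m n : ℕ, (∫⁻ x, min (f x) m) ^ a * (∫⁻ x, min (g x) n) ^ b ≤ ∫⁻ x, h x := by
    intro m n
    have hb' : ∀ (u : ℝ → ℝ≥0∞) (k : ℕ), ⨆ x, min (u x) k ≠ ∞ := fun u k =>
      ne_top_of_le_ne_top (ENNReal.natCast_ne_top k) (iSup_le fun x => min_le_right _ _)
    refine lintegral_rpow_mul_le_of_bounded (hf.min measurable_const) (hg.min measurable_const) hh
      ha hb hab (fun x y => le_trans ?_ (hfgh x y)) (hb' f m) (hb' g n)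
    gcongr <;> exact min_le_left _ _
  -- Excluding zero integrals keeps the limit of the products away from 0 · ∞.
  rcases eq_or_ne (∫⁻ x, f x) 0 with hf0 | hf0
  · simp [hf0, ha]
  rcases eq_or_ne (∫⁻ x, g x) 0 with hg0 | hg0
  · simp [hg0, hb]
  refine le_of_tendsto (ENNReal.Tendsto.mul ((ENNReal.continuous_rpow_const.tendsto _).comp
    (hlim f hf)) (.inl ?_) ((ENNReal.continuous_rpow_const.tendsto _).comp (hlim g hg)) (.inl ?_))
    (.of_forall fun n => hle n n)
  · simp [hf0, ha.le]
  · simp [hg0, hb.le]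

/-- By Tonelli: the inequality on the fibres F is the hypothesis needed for the partial integrals on
E. -/
theorem PrekopaLeindler.prod {E F : Type*} [AddCommGroup E] [Module ℝ E] [MeasureSpace E]
    [AddCommGroup F] [Module ℝ F] [MeasureSpace F] [SFinite (volume : Measure E)]
    [SFinite (volume : Measure F)]
    (hE : PrekopaLeindler E) (hF : PrekopaLeindler F) : PrekopaLeindler (E × F) := by
  intro f g h hf hg hh a b ha hb hab hfgh
  rw [Measure.volume_eq_prod, lintegral_prod _ hf.aemeasurable, lintegral_prod _ hg.aemeasurable,
    lintegral_prod _ hh.aemeasurable]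
  refine hE _ _ _ hf.lintegral_prod_right' hg.lintegral_prod_right' hh.lintegral_prod_right' a b
    ha hb hab fun s t => ?_
  exact hF _ _ _ (hf.comp measurable_prodMk_left) (hg.comp measurable_prodMk_left)
    (hh.comp measurable_prodMk_left) a b ha hb hab fun x y => hfgh (s, x) (t, y)

theorem PrekopaLeindler.of_equiv {E F : Type*} [AddCommGroup E] [Module ℝ E] [MeasureSpace E]
    [AddCommGroup F] [Module ℝ F] [MeasureSpace F] (hE : PrekopaLeindler E) (e : E → F)
    (he : MeasurePreserving e) (hadd : ∀ x y, e (x + y) = e x + e y)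
    (hsmul : ∀ (c : ℝ) x, e (c • x) = c • e x) : PrekopaLeindler F := by
  intro f g h hf hg hh a b ha hb hab hfgh
  rw [← he.lintegral_comp hf, ← he.lintegral_comp hg, ← he.lintegral_comp hh]
  refine hE _ _ _ (hf.comp he.measurable) (hg.comp he.measurable) (hh.comp he.measurable) a b
    ha hb hab fun x y => ?_
  simpa only [Function.comp_apply, hadd, hsmul] using hfgh (e x) (e y)

theorem prekopaLeindler_pi (n : ℕ) : PrekopaLeindler (Fin n → ℝ) := by
  induction n with
  | zero =>
    intro f g h hf hg hh a b ha hb hab hfgh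
    simp only [lintegral_unique, volume_pi, Measure.pi_univ, Finset.univ_eq_empty,
      Finset.prod_empty, mul_one]
    convert hfgh default default
  | succ n ih =>
    refine (prekopaLeindler_real.prod ih).of_equiv
      (MeasurableEquiv.piFinSuccAbove (fun _ => ℝ) 0).symm
      (volume_preserving_piFinSuccAbove (fun _ => ℝ) 0).symm ?_ ?_
    · intro x y
      ext i
      refine Fin.cases ?_ (fun j => ?_) i <;> simp [MeasurableEquiv.piFinSuccAbove]
    · intro c x
      ext i
      refine Fin.cases ?_ (fun j => ?_) i <;> simp [MeasurableEquiv.piFinSuccAbove]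

/-- The Prékopa–Leindler inequality. -/
theorem prekopaLeindler_euclideanSpace (n : ℕ) : PrekopaLeindler (EuclideanSpace ℝ (Fin n)) :=
  (prekopaLeindler_pi n).of_equiv _ (PiLp.volume_preserving_toLp (Fin n)) (fun _ _ => rfl)
    fun _ _ => rfl

/-! ### Log-concave functions and their perspective. -/

namespace IsLogConcave

variable {n : ℕ} {f : EuclideanSpace ℝ (Fin n) → ℝ}

theorem convex_support {E : Type*} [AddCommGroup E] [Module ℝ E] {f : E → ℝ}
    (hf : IsLogConcave f) : Convex ℝ {x | 0 < f x} := by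
  rw [convex_iff_forall_pos]
  intro x hx y hy a b ha hb hab
  exact lt_of_lt_of_le (mul_pos (Real.rpow_pos_of_pos hx a) (Real.rpow_pos_of_pos hy b))
    (hf.rpow_mul_rpow_le x y a b ha hb hab)

theorem concaveOn_log {E : Type*} [AddCommGroup E] [Module ℝ E] {f : E → ℝ}
    (hf : IsLogConcave f) : ConcaveOn ℝ {x | 0 < f x} (fun x => Real.log (f x)) := by
  rw [concaveOn_iff_forall_pos]
  refine ⟨hf.convex_support, fun x hx y hy a b ha hb hab => ?_⟩
  have hx' := Real.rpow_pos_of_pos hx a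
  have hy' := Real.rpow_pos_of_pos hy b
  have := Real.log_le_log (mul_pos hx' hy') (hf.rpow_mul_rpow_le x y a b ha hb hab)
  rwa [Real.log_mul hx'.ne' hy'.ne', Real.log_rpow hx, Real.log_rpow hy] at this

theorem indicator {E : Type*} [AddCommGroup E] [Module ℝ E] {f : E → ℝ}
    (hf : IsLogConcave f) {s : Set E} (hs : Convex ℝ s) : IsLogConcave (s.indicator f) where
  nonneg x := Set.indicator_nonneg (fun x _ => hf.nonneg x) x
  rpow_mul_rpow_le x y a b ha hb hab := by
    by_cases hx : x ∈ s
    · by_cases hy : y ∈ s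
      · rw [Set.indicator_of_mem hx, Set.indicator_of_mem hy,
          Set.indicator_of_mem (hs hx hy ha.le hb.le hab)]
        exact hf.rpow_mul_rpow_le x y a b ha hb hab
      · rw [Set.indicator_of_notMem hy, Real.zero_rpow hb.ne', mul_zero]
        exact Set.indicator_nonneg (fun x _ => hf.nonneg x) _
    · rw [Set.indicator_of_notMem hx, Real.zero_rpow ha.ne', zero_mul]
      exact Set.indicator_nonneg (fun x _ => hf.nonneg x) _

/-- A log-concave function agrees almost everywhere with a Borel measurable one. -/
theorem exists_measurable_ae_eq (hf : IsLogConcave f) :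
    ∃ g : EuclideanSpace ℝ (Fin n) → ℝ, IsLogConcave g ∧ Measurable g ∧ f =ᵐ[volume] g := by
  -- On U, log f is concave, hence continuous; the frontier of a convex set is null.
  set U := interior {x | 0 < f x} with hU
  have hUo : IsOpen U := isOpen_interior
  refine ⟨U.indicator f, hf.indicator hf.convex_support.interior, ?_, ?_⟩
  · have hc : ContinuousOn f U := by
      refine (Real.continuous_exp.comp_continuousOn
        hf.concaveOn_log.continuousOn_interior).congr fun x hx => ?_
      exact (Real.exp_log (show x ∈ {x | 0 < f x} from interior_subset hx)).symm
    classical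
    rw [← Set.piecewise_eq_indicator]
    exact hc.measurable_piecewise continuousOn_const hUo.measurableSet
  · have h0 : volume (frontier {x | 0 < f x}) = 0 := hf.convex_support.addHaar_frontier volume
    filter_upwards [compl_mem_ae_iff.2 h0] with x hx
    by_cases hxU : x ∈ U
    · rw [Set.indicator_of_mem hxU]
    · rw [Set.indicator_of_notMem hxU]
      by_contra hne
      exact hx ⟨subset_closure (lt_of_le_of_ne (hf.nonneg x) (Ne.symm hne)), hxU⟩

/-- The Prékopa marginal inequality for the perspective `(x, α) ↦ f (x / α) ^ α`. -/
theorem lintegral_rpow_log_concave (hf : IsLogConcave f) {α β a b : ℝ} (hα : 0 < α) (hβ : 0 < β)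
    (ha : 0 < a) (hb : 0 < b) (hab : a + b = 1) :
    (ENNReal.ofReal (α ^ n) * ∫⁻ x, ENNReal.ofReal (f x ^ α)) ^ a *
      (ENNReal.ofReal (β ^ n) * ∫⁻ x, ENNReal.ofReal (f x ^ β)) ^ b ≤
      ENNReal.ofReal ((a * α + b * β) ^ n) * ∫⁻ x, ENNReal.ofReal (f x ^ (a * α + b * β)) := by
  obtain ⟨g, hg, hgm, hfg⟩ := hf.exists_measurable_ae_eq
  have hcongr : ∀ γ : ℝ, ∫⁻ x, ENNReal.ofReal (f x ^ γ) = ∫⁻ x, ENNReal.ofReal (g x ^ γ) :=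
    fun γ => lintegral_congr_ae (hfg.mono fun x hx => by simp only [hx])
  have hscale : ∀ γ : ℝ, 0 < γ → ENNReal.ofReal (γ ^ n) * ∫⁻ x, ENNReal.ofReal (f x ^ γ) =
      ∫⁻ x, ENNReal.ofReal (g (γ⁻¹ • x) ^ γ) := by
    intro γ hγ
    have hm : Measurable fun x => ENNReal.ofReal (g x ^ γ) := by fun_prop
    rw [hcongr, ← lintegral_map (g := fun x => γ⁻¹ • x) hm (measurable_const_smul _),
      Measure.map_addHaar_smul _ (inv_ne_zero hγ.ne'), lintegral_smul_measure]
    simp [abs_of_pos hγ]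
  have hγ : 0 < a * α + b * β := by positivity
  rw [hscale α hα, hscale β hβ, hscale _ hγ]
  refine prekopaLeindler_euclideanSpace n _ _ _ (by fun_prop) (by fun_prop) (by fun_prop) a b ha hb
    hab fun x y => ?_
  rw [ENNReal.ofReal_rpow_of_nonneg (Real.rpow_nonneg (hg.nonneg _) _) ha.le,
    ENNReal.ofReal_rpow_of_nonneg (Real.rpow_nonneg (hg.nonneg _) _) hb.le,
    ← ENNReal.ofReal_mul (Real.rpow_nonneg (Real.rpow_nonneg (hg.nonneg _) _) _)]
  refine ENNReal.ofReal_le_ofReal ?_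
  set γ := a * α + b * β with hγd
  -- (ax + by)/γ is the convex combination of x/α and y/β with weights aα/γ and bβ/γ; raising to the
  -- power γ restores the exponents.
  have h1 := Real.rpow_le_rpow
    (mul_nonneg (Real.rpow_nonneg (hg.nonneg _) _) (Real.rpow_nonneg (hg.nonneg _) _))
    (hg.rpow_mul_rpow_le (α⁻¹ • x) (β⁻¹ • y) (a * α / γ) (b * β / γ) (by positivity)
    (by positivity) (by rw [← add_div, div_self hγ.ne'])) hγ.le
  rw [Real.mul_rpow (Real.rpow_nonneg (hg.nonneg _) _) (Real.rpow_nonneg (hg.nonneg _) _),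
    ← Real.rpow_mul (hg.nonneg _), ← Real.rpow_mul (hg.nonneg _), div_mul_cancel₀ _ hγ.ne',
    div_mul_cancel₀ _ hγ.ne', mul_comm a, mul_comm b, Real.rpow_mul (hg.nonneg _),
    Real.rpow_mul (hg.nonneg _)] at h1
  convert h1 using 3
  simp only [smul_smul, smul_add]
  congr 2 <;> field_simp

end IsLogConcave

/-! ### Exponential moments of log f(X). -/

theorem HasDensity.lintegral_exp_mul_log {Ω : Type*} [MeasurableSpace Ω] {P : Measure Ω} {n : ℕ}
    {X : Ω → EuclideanSpace ℝ (Fin n)} {f : EuclideanSpace ℝ (Fin n) → ℝ} (hX : HasDensity X P f)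
    {s : ℝ} (hs : -1 < s) :
    ∫⁻ ω, ENNReal.ofReal (Real.exp (s * Real.log (f (X ω)))) ∂P =
      ∫⁻ x, ENNReal.ofReal (f x ^ (1 + s)) := by
  have hfm := hX.density_aemeasurable
  have hm : AEMeasurable (fun x => ENNReal.ofReal (Real.exp (s * Real.log (f x)))) volume := by
    fun_prop
  have hm' : AEMeasurable (fun x => ENNReal.ofReal (Real.exp (s * Real.log (f x)))) (P.map X) :=
    hm.mono_ac (hX.map_eq ▸ withDensity_absolutelyContinuous _ _)
  rw [← lintegral_map' hm' hX.aemeasurable, hX.map_eq,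
    lintegral_withDensity_eq_lintegral_mul₀ hfm.ennreal_ofReal hm]
  refine lintegral_congr fun x => ?_
  rw [Pi.mul_apply, ← ENNReal.ofReal_mul (hX.density_nonneg x)]
  congr 1
  rcases (hX.density_nonneg x).eq_or_lt with h0 | h0
  -- Where f = 0 the convention log 0 = 0 does not matter: the weight f vanishes, and so does
  -- f^(1+s) because 1 + s > 0.
  · rw [← h0, zero_mul, Real.zero_rpow (by linarith)]
  · rw [Real.rpow_add h0, Real.rpow_one, Real.rpow_def_of_pos h0, mul_comm s]

theorem HasDensity.aemeasurable_log {Ω : Type*} [MeasurableSpace Ω] {P : Measure Ω} {n : ℕ}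
    {X : Ω → EuclideanSpace ℝ (Fin n)} {f : EuclideanSpace ℝ (Fin n) → ℝ} (hX : HasDensity X P f) :
    AEMeasurable (fun ω => Real.log (f (X ω))) P := by
  have hfm := hX.density_aemeasurable
  have hm : AEMeasurable (fun x => Real.log (f x)) volume := by fun_prop
  exact (hm.mono_ac (hX.map_eq ▸ withDensity_absolutelyContinuous _ _)).comp_aemeasurable
    hX.aemeasurable

/-- The graph of a concave function lies below its tangents. -/
theorem ConcaveOn.le_tangent {S : Set ℝ} {H : ℝ → ℝ} (hH : ConcaveOn ℝ S H) {x y d : ℝ}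
    (hx : x ∈ S) (hy : y ∈ S) (hd : HasDerivAt H d x) : H y ≤ H x + d * (y - x) := by
  rcases lt_trichotomy x y with h | h | h
  · have := hH.slope_le_of_hasDerivAt hx hy h hd
    rw [slope_def_field, div_le_iff₀ (sub_pos.2 h)] at this
    linarith
  · simp [h]
  · have := hH.le_slope_of_hasDerivAt hy hx h hd
    rw [slope_def_field, le_div_iff₀ (sub_pos.2 h)] at this
    linarith

open ProbabilityTheory in
/-- If `α ↦ α ^ n * 𝔼 exp ((α - 1) Y)` is log-concave on `(0, ∞)`, with values in `[0, ∞]`, then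
all its values are finite. -/
theorem integrable_exp_mul_of_log_concave {Ω : Type*} [MeasurableSpace Ω] {P : Measure Ω}
    [IsProbabilityMeasure P] {n : ℕ} {Y : Ω → ℝ} (hY : AEMeasurable Y P)
    (h : ∀ α β a b : ℝ, 0 < α → 0 < β → 0 < a → 0 < b → a + b = 1 →
      (ENNReal.ofReal (α ^ n) * ∫⁻ ω, ENNReal.ofReal (Real.exp ((α - 1) * Y ω)) ∂P) ^ a *
      (ENNReal.ofReal (β ^ n) * ∫⁻ ω, ENNReal.ofReal (Real.exp ((β - 1) * Y ω)) ∂P) ^ b ≤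
      ENNReal.ofReal ((a * α + b * β) ^ n) *
        ∫⁻ ω, ENNReal.ofReal (Real.exp ((a * α + b * β - 1) * Y ω)) ∂P) {s : ℝ} (hs : -1 < s) :
    Integrable (fun ω => Real.exp (s * Y ω)) P := by
  have hm : ∀ s : ℝ, AEMeasurable (fun ω => Real.exp (s * Y ω)) P := fun s => by fun_prop
  refine ⟨(hm s).aestronglyMeasurable, ?_⟩
  rw [hasFiniteIntegral_iff_ofReal (.of_forall fun ω => (Real.exp_pos _).le), lt_top_iff_ne_top]
  intro htop
  have hα : 0 < 1 + s := by linarith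
  -- The weights average 1 + s and its inverse to 1, where the value is 1; an infinite value at 1 +
  -- s would force ∞ ≤ 1.
  have key := h (1 + s) (1 + s)⁻¹ (1 / (1 + (1 + s))) ((1 + s) / (1 + (1 + s))) hα
    (inv_pos.2 hα) (by positivity) (by positivity) (by field_simp)
  have h1 : 1 / (1 + (1 + s)) * (1 + s) + (1 + s) / (1 + (1 + s)) * (1 + s)⁻¹ = 1 := by
    field_simp
    ring
  have hpos : ∫⁻ ω, ENNReal.ofReal (Real.exp (((1 + s)⁻¹ - 1) * Y ω)) ∂P ≠ 0 := by
    rw [Ne, lintegral_eq_zero_iff' (hm _).ennreal_ofReal]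
    intro h0
    obtain ⟨ω, hω⟩ := h0.exists
    exact absurd hω (by simp [Real.exp_pos])
  rw [h1, add_sub_cancel_left, htop, ENNReal.mul_top (by simp; positivity),
    ENNReal.top_rpow_of_pos (by positivity), ENNReal.top_mul] at key
  · simp at key
  · have : ENNReal.ofReal ((1 + s)⁻¹ ^ n) ≠ 0 := by simp; positivity
    rw [Ne, ENNReal.rpow_eq_zero_iff_of_pos (by positivity)]
    exact mul_ne_zero this hpos

open ProbabilityTheory in
/-- If `α ↦ α ^ n * 𝔼 exp ((α - 1) Y)` is log-concave on `(0, ∞)`, then `Y` is integrable, and its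
cumulant generating function lies below the one of minus a Gamma variable of shape `n` with the
same mean. -/
theorem cgf_le_of_log_concave {Ω : Type*} [MeasurableSpace Ω] {P : Measure Ω}
    [IsProbabilityMeasure P] {n : ℕ} {Y : Ω → ℝ} (hY : AEMeasurable Y P)
    (h : ∀ α β a b : ℝ, 0 < α → 0 < β → 0 < a → 0 < b → a + b = 1 →
      (ENNReal.ofReal (α ^ n) * ∫⁻ ω, ENNReal.ofReal (Real.exp ((α - 1) * Y ω)) ∂P) ^ a *
      (ENNReal.ofReal (β ^ n) * ∫⁻ ω, ENNReal.ofReal (Real.exp ((β - 1) * Y ω)) ∂P) ^ b ≤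
      ENNReal.ofReal ((a * α + b * β) ^ n) *
        ∫⁻ ω, ENNReal.ofReal (Real.exp ((a * α + b * β - 1) * Y ω)) ∂P) :
    Integrable Y P ∧ ∀ s : ℝ, -1 < s → Integrable (fun ω => Real.exp (s * Y ω)) P ∧
      cgf Y P s ≤ s * (∫ ω, Y ω ∂P) + n * (s - Real.log (1 + s)) := by
  have hint : ∀ s : ℝ, -1 < s → Integrable (fun ω => Real.exp (s * Y ω)) P := fun s hs =>
    integrable_exp_mul_of_log_concave hY h hs
  have h0 : (0 : ℝ) ∈ interior (integrableExpSet Y P) :=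
    mem_interior.2 ⟨Set.Ioi (-1), fun s hs => hint s hs, isOpen_Ioi, by simp⟩
  refine ⟨integrable_of_mem_interior_integrableExpSet h0, fun s hs => ⟨hint s hs, ?_⟩⟩
  have hG : ∀ α : ℝ, 0 < α → ENNReal.ofReal (α ^ n) *
      ∫⁻ ω, ENNReal.ofReal (Real.exp ((α - 1) * Y ω)) ∂P =
      ENNReal.ofReal (Real.exp (n * Real.log α + cgf Y P (α - 1))) := by
    intro α hα
    rw [← ofReal_integral_eq_lintegral_ofReal (hint _ (by linarith))
      (.of_forall fun ω => (Real.exp_pos _).le), ← ENNReal.ofReal_mul (by positivity), Real.exp_add,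
      exp_cgf (hint _ (by linarith)), mul_comm (n : ℝ), ← Real.rpow_def_of_pos hα,
      Real.rpow_natCast, mgf]
  have hconc : ConcaveOn ℝ (Set.Ioi 0) fun α : ℝ => n * Real.log α + cgf Y P (α - 1) := by
    rw [concaveOn_iff_forall_pos]
    refine ⟨convex_Ioi 0, fun α (hα : 0 < α) β (hβ : 0 < β) a b ha hb hab => ?_⟩
    have key := h α β a b hα hβ ha hb hab
    rw [hG α hα, hG β hβ, hG _ (by positivity), ENNReal.ofReal_rpow_of_pos (Real.exp_pos _),
      ENNReal.ofReal_rpow_of_pos (Real.exp_pos _), ← ENNReal.ofReal_mul (by positivity),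
      ENNReal.ofReal_le_ofReal_iff (Real.exp_pos _).le, ← Real.exp_mul, ← Real.exp_mul,
      ← Real.exp_add, Real.exp_le_exp] at key
    simp only [smul_eq_mul]
    linarith
  have hderiv : HasDerivAt (fun α : ℝ => n * Real.log α + cgf Y P (α - 1))
      (n + ∫ ω, Y ω ∂P) 1 := by
    have h1 : HasDerivAt (cgf Y P) (∫ ω, Y ω ∂P) (1 - 1) := by
      have := (analyticAt_cgf h0).differentiableAt.hasDerivAt
      rw [deriv_cgf_zero h0] at this
      simpa using this
    have h2 := ((Real.hasDerivAt_log one_ne_zero).const_mul (n : ℝ)).add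
      (h1.comp_sub_const 1 1)
    simpa [Pi.add_def] using! h2
  have := hconc.le_tangent (x := 1) (y := 1 + s) (by simp) (Set.mem_Ioi.2 (by linarith)) hderiv
  simp only [Real.log_one, mul_zero, sub_self, cgf_zero, add_zero, zero_add,
    add_sub_cancel_left] at this
  linarith

/-! ### Chernoff bounds and conclusion. -/

/-- With u = s - s²/16 ≥ 7s/8, the bound e^u ≥ 1 + u + u²/2 suffices, as 49/128 > 1/16. This
lower-tail estimate is the source of the constant 1/16. -/
theorem Real.log_one_add_le_sub_sq {s : ℝ} (h0 : 0 ≤ s) (h2 : s ≤ 2) :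
    Real.log (1 + s) ≤ s - s ^ 2 / 16 := by
  rw [Real.log_le_iff_le_exp (by linarith)]
  have hu : 0 ≤ s - s ^ 2 / 16 := by nlinarith
  refine le_trans ?_ (Real.quadratic_le_exp_of_nonneg hu)
  have : s * (7 / 8) ≤ s - s ^ 2 / 16 := by nlinarith
  nlinarith [pow_le_pow_left₀ (by positivity) this 2]

theorem Real.sub_sq_half_le_log_one_add {s : ℝ} (h0 : 0 ≤ s) :
    s - s ^ 2 / 2 ≤ Real.log (1 + s) := by
  refine le_trans ?_ (Real.le_log_one_add_of_nonneg h0)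
  rw [le_div_iff₀ (by linarith)]
  nlinarith [pow_nonneg h0 3]

open ProbabilityTheory in
/-- Deviation inequality for a random variable whose cumulant generating function lies below the
one of minus a Gamma variable of shape `n` with the same mean. -/
theorem measureReal_abs_sub_integral_ge_le {Ω : Type*} [MeasurableSpace Ω] {P : Measure Ω}
    [IsProbabilityMeasure P] {n : ℕ} {Y : Ω → ℝ}
    (h : ∀ s : ℝ, -1 < s → Integrable (fun ω => Real.exp (s * Y ω)) P ∧
      cgf Y P s ≤ s * (∫ ω, Y ω ∂P) + n * (s - Real.log (1 + s)))
    {s : ℝ} (h0 : 0 ≤ s) (h2 : s ≤ 2) :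
    P.real {ω | n * s ≤ |Y ω - ∫ ω', Y ω' ∂P|} ≤ 2 * Real.exp (-(n * s ^ 2 / 16)) := by
  set m := ∫ ω', Y ω' ∂P with hm
  have hn : (0 : ℝ) ≤ n := n.cast_nonneg
  have hup : P.real {ω | m + n * s ≤ Y ω} ≤ Real.exp (-(n * s ^ 2 / 16)) := by
    -- The parameter s is not optimal, but already gives exponent -ns²/2.
    obtain ⟨hi, hc⟩ := h s (by linarith)
    refine (measure_ge_le_exp_cgf _ h0 hi).trans (Real.exp_le_exp.2 ?_)
    nlinarith [mul_le_mul_of_nonneg_left (Real.sub_sq_half_le_log_one_add h0) hn,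
      mul_nonneg hn (sq_nonneg s)]
  have hlow : P.real {ω | Y ω ≤ m - n * s} ≤ Real.exp (-(n * s ^ 2 / 16)) := by
    have hs1 : 0 < 1 + s := by linarith
    -- The parameter -s/(1+s) minimises the Chernoff exponent obtained from the bound on `cgf`, with
    -- value n(log(1+s) - s).
    have he : 1 + -(s / (1 + s)) = (1 + s)⁻¹ := by field_simp; ring
    obtain ⟨hi, hc⟩ := h (-(s / (1 + s))) (by linarith [he, inv_pos.2 hs1])
    refine (measure_le_le_exp_cgf _ (neg_nonpos.2 (by positivity)) hi).trans
      (Real.exp_le_exp.2 ?_)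
    rw [he, Real.log_inv] at hc
    have h3 : s / (1 + s) * (n * s) + n * (s / (1 + s)) = n * s := by
      field_simp
      ring
    nlinarith [mul_le_mul_of_nonneg_left (Real.log_one_add_le_sub_sq h0 h2) hn]
  calc P.real {ω | n * s ≤ |Y ω - m|}
      ≤ P.real ({ω | m + n * s ≤ Y ω} ∪ {ω | Y ω ≤ m - n * s}) := by
        refine measureReal_mono fun ω hω => ?_
        rcases le_abs.1 (show n * s ≤ |Y ω - m| from hω) with h | h
        · exact .inl (show m + n * s ≤ Y ω by linarith)
        · exact .inr (show Y ω ≤ m - n * s by linarith)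
    _ ≤ _ := measureReal_union_le _ _
    _ ≤ _ := by linarith

theorem theorem1p2 {Ω : Type*} [MeasurableSpace Ω] (P : Measure Ω) [IsProbabilityMeasure P]
    (n : ℕ) (hn : 1 ≤ n) (X : Ω → EuclideanSpace ℝ (Fin n))
    (f : EuclideanSpace ℝ (Fin n) → ℝ) (hf : IsLogConcave f) (hX : HasDensity X P f) :
    Integrable (fun ω => Real.log (f (X ω))) P ∧
    ∀ t : ℝ, 0 ≤ t → t ≤ 2 * Real.sqrt (n : ℝ) →
      P.real {ω | t ≤ 1 / Real.sqrt (n : ℝ) *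
          |Real.log (f (X ω)) - ∫ ω', Real.log (f (X ω')) ∂P|}
        ≤ 3 * Real.exp (-(1 / 16 : ℝ) * t ^ 2) := by
  obtain ⟨hint, hcgf⟩ := cgf_le_of_log_concave (n := n) hX.aemeasurable_log
    fun α β a b hα hβ ha hb hab => by
      have hγ : 0 < a * α + b * β := by positivity
      rw [hX.lintegral_exp_mul_log (by linarith), hX.lintegral_exp_mul_log (by linarith),
        hX.lintegral_exp_mul_log (by linarith)]
      simpa only [add_sub_cancel] using hf.lintegral_rpow_log_concave hα hβ ha hb hab
  refine ⟨hint, fun t ht0 ht2 => ?_⟩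
  have hn0 : (0 : ℝ) < n := by exact_mod_cast hn
  have hr : 0 < Real.sqrt n := Real.sqrt_pos.2 hn0
  have hrr : Real.sqrt n * Real.sqrt n = n := Real.mul_self_sqrt hn0.le
  have hns : (n : ℝ) * (t / Real.sqrt n) = t * Real.sqrt n := by
    rw [mul_div_assoc', div_eq_iff hr.ne', mul_assoc, hrr, mul_comm]
  have hns2 : (n : ℝ) * (t / Real.sqrt n) ^ 2 = t ^ 2 := by
    rw [sq, ← mul_assoc, hns]
    field_simp
  have key := measureReal_abs_sub_integral_ge_le hcgf (s := t / Real.sqrt n) (by positivity)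
    (by rwa [div_le_iff₀ hr])
  rw [hns, hns2] at key
  have hset : {ω | t ≤ 1 / Real.sqrt n * |Real.log (f (X ω)) - ∫ ω', Real.log (f (X ω')) ∂P|} =
      {ω | t * Real.sqrt n ≤ |Real.log (f (X ω)) - ∫ ω', Real.log (f (X ω')) ∂P|} := by
    ext ω
    rw [Set.mem_ofPred_eq, Set.mem_ofPred_eq, one_div, inv_mul_eq_div, le_div_iff₀ hr]
  rw [hset, show -(1 / 16 : ℝ) * t ^ 2 = -(t ^ 2 / 16) by ring]
  -- The two tails give the factor 2, which is weakened to 3.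
  linarith [Real.exp_pos (-(t ^ 2 / 16))]
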